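/- All Banach spaces are over the same field $\mathbb K\in\{\mathbb R,\mathbb C\}$; $B_X$ is the closed unit ball of $X$. Let $1\le p<\infty$ and let $p^*\in(1,\infty]$ be the conjugate index, $1/p+1/p^*=1$ (with $1/\infty=0$). Throughout, the symbol $\ell_\infty$ stands for $c_0$ (this matters only when $p=1$, $p^*=\infty$). Let $X$ be a Banach space. **Definitions.** A sequence $(z_k)$ in $X$ is in $\ell_p^w(X)$ if $\sum_k|x^*(z_k)|^p<\infty$ for all $x^*\in X^*$; its norm is $\|(z_k)\|_p^w=\sup_{x^*\in B_{X^*}}\big(\sum_k|x^*(z_k)|^p\big)^{1/p}$. The space $\ell_p^u(X)$ of unconditionally $p$-summable sequences consists of the $(z_k)\in\ell_p^w(X)$ with $\|(z_k)-(z_1,\dots,z_N,0,0,\dots)\|_p^w\to0$ as $N\to\infty$, and carries the same norm. For $(z_k)\in\ell_p^u(X)$ put $p\text{-conv}(z_k)=\{\sum_{k}a_kz_k:(a_k)\in B_{\ell_{p^*}}\}$. A subset of $X$ is *relatively unconditionally $p$-compact* if it is contained in $p\text{-conv}(z_k)$ for some $(z_k)\in\ell_p^u(X)$. A sequence $(x_n)$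 in $X$ is *unconditionally $p$-null* if for every $\varepsilon>0$ there are $(z_k)\in\ell_p^u(X)$ with $\|(z_k)\|_p^w\le\varepsilon$ and $N\in\mathbb N$ such that $x_n\in p\text{-conv}(z_k)$ for all $n\ge N$; it is *uniformly unconditionally $p$-null* if there is $(z_k)\in\ell_p^u(X)$ with $\|(z_k)\|_p^w\le1$ such that for every $\varepsilon>0$ there is $N\in\mathbb N$ with $x_n\in\varepsilon\,p\text{-conv}(z_k)$ for all $n\ge N$. For a Banach space $Y$, $\mathcal U_p(Y,X)$ is the set of bounded linear operators $T:Y\to X$ for which $T(B_Y)$ is relatively unconditionally $p$-compact, and $\mathrm K_{p^*}(Y,X)$ (the classical $p^*$-compact operators) is the set of all $T=BA$ with compact linear operators $A:Y\to\ell_{p^*}$ and $B:\ell_{p^*}\to X$. For $\mathcal A\in\{\mathcal U_p,\mathrm K_{p^*}\}$, a subset $K\subset X$ is *$\mathcal A$-compact* if $K\subset T(F)$ for some Banach space $Y$, some relatively compact $F\subset Y$ and some $T\in\mathcal A(Y,X)$; a sequence $(x_n)$ in $X$ is *$\mathcal A$-null* if there are a Banach space $Y$, a null sequence $(y_n)$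 in $Y$ and $T\in\mathcal A(Y,X)$ with $x_n=Ty_n$ for all $n$. A sequence is said to have a compactness property when the set of its terms has it; *null* means norm convergent to $0$. **Statement.** For every sequence $(x_n)$ in $X$ the following are equivalent: (a) $(x_n)$ is unconditionally $p$-null; (b) $(x_n)$ is null and relatively unconditionally $p$-compact; (c) $(x_n)$ is null and $\mathrm K_{p^*}$-compact; (d) $(x_n)$ is null and $\mathcal U_p$-compact; (e) $(x_n)$ is $\mathrm K_{p^*}$-null; (f) $(x_n)$ is $\mathcal U_p$-null; (g) $(x_n)$ is uniformly unconditionally $p$-null. -/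

import Mathlib

open Filter Topology
open scoped ENNReal

universe u w

namespace PNull

/-! Scalars: `𝕜` is the real or the complex field. Sequences are indexed by `ℕ`, starting at `0`. -/

section Sequences

/-- The Banach space `ℓ_r` of scalar sequences, with the convention that `ℓ_∞` stands for `c₀`:
all of `ℓ_r` if `r < ∞`, and the null sequences with the supremum norm if `r = ∞`. -/
def ell (𝕜 : Type) [RCLike 𝕜] (r : ℝ≥0∞) [Fact (1 ≤ r)] :
    Submodule 𝕜 (lp (fun _ : ℕ => 𝕜) r) where
  carrier := {a | r = ∞ → Tendsto (fun k => a k) atTop (𝓝 0)}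
  zero_mem' := fun _ => by simp
  add_mem' := fun {a b} ha hb hr => by simpa using (ha hr).add (hb hr)
  smul_mem' := fun c a ha hr => by simpa using (ha hr).const_smul c

variable (𝕜 : Type) [RCLike 𝕜] {X : Type u} [NormedAddCommGroup X] [NormedSpace 𝕜 X]

/-- `z` is weakly `p`-summable, that is, `z ∈ ℓ_p^w(X)`. -/
def WeaklySummable (p : ℝ) (z : ℕ → X) : Prop :=
  ∀ f : StrongDual 𝕜 X, Summable fun k => ‖f (z k)‖ ^ p

/-- The weak `p`-norm `‖z‖_p^w = sup {(∑ₖ |f (z k)|^p)^(1/p) : f ∈ B_{X*}}`,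
as an extended nonnegative number. -/
noncomputable def weakNorm (p : ℝ) (z : ℕ → X) : ℝ≥0∞ :=
  ⨆ (f : StrongDual 𝕜 X) (_ : ‖f‖ ≤ 1), (∑' k, ‖f (z k)‖ₑ ^ p) ^ (1 / p)

/-- `z` is unconditionally `p`-summable, that is, `z ∈ ℓ_p^u(X)`: it is weakly `p`-summable and
it is the limit in the weak `p`-norm of its truncations `(z 0, …, z (N - 1), 0, 0, …)`. -/
def UncondSummable (p : ℝ) (z : ℕ → X) : Prop :=
  WeaklySummable 𝕜 p z ∧
    Tendsto (fun N : ℕ => weakNorm 𝕜 p (z - fun k => if k < N then z k else 0)) atTop (𝓝 0)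

/-- The `(p, r)`-convex hull `{∑ₖ aₖ zₖ : (aₖ) ∈ B_{ℓ_r}}` of a sequence `z`
(the set itself does not involve `p`). -/
def conv (r : ℝ≥0∞) [Fact (1 ≤ r)] (z : ℕ → X) : Set X :=
  {x | ∃ a : ell 𝕜 r, ‖a‖ ≤ 1 ∧ HasSum (fun k => (a : lp (fun _ : ℕ => 𝕜) r) k • z k) x}

/-- Unconditionally `(p, r)`-null sequences. -/
def UncondNull (p : ℝ) (r : ℝ≥0∞) [Fact (1 ≤ r)] (x : ℕ → X) : Prop :=
  ∀ ε : ℝ, 0 < ε → ∃ z : ℕ → X, UncondSummable 𝕜 p z ∧ weakNorm 𝕜 p z ≤ ENNReal.ofReal ε ∧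
    ∃ N : ℕ, ∀ n, N ≤ n → x n ∈ conv 𝕜 r z

/-- Uniformly unconditionally `(p, r)`-null sequences. -/
def UnifUncondNull (p : ℝ) (r : ℝ≥0∞) [Fact (1 ≤ r)] (x : ℕ → X) : Prop :=
  ∃ z : ℕ → X, UncondSummable 𝕜 p z ∧ weakNorm 𝕜 p z ≤ 1 ∧
    ∀ ε : ℝ, 0 < ε → ∃ N : ℕ, ∀ n, N ≤ n → ∃ y ∈ conv 𝕜 r z, x n = (ε : 𝕜) • y

/-- Relatively unconditionally `(p, r)`-compact sets. -/
def RelUncondCompact (p : ℝ) (r : ℝ≥0∞) [Fact (1 ≤ r)] (K : Set X) : Prop :=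
  ∃ z : ℕ → X, UncondSummable 𝕜 p z ∧ K ⊆ conv 𝕜 r z

end Sequences

section Operators

/-- A class `𝒜` of bounded linear operators from Banach spaces `Y` into the fixed space `X`
(the components `𝒜(Y, X)`, where `X` is fixed and `Y` varies). -/
abbrev OperatorClass (𝕜 : Type) [RCLike 𝕜] (X : Type u) [NormedAddCommGroup X]
    [NormedSpace 𝕜 X] : Type (max u (w + 1)) :=
  ∀ (Y : Type w) [NormedAddCommGroup Y] [NormedSpace 𝕜 Y] [CompleteSpace Y],
    (Y →L[𝕜] X) → Prop

variable {𝕜 : Type} [RCLike 𝕜] {X : Type u} [NormedAddCommGroup X] [NormedSpace 𝕜 X]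

/-- `𝒜`-null sequences: images under some `T ∈ 𝒜(Y, X)` of null sequences of `Y`. -/
def OperatorClass.NullSeq (𝒜 : OperatorClass.{u, w} 𝕜 X) (x : ℕ → X) : Prop :=
  ∃ (Y : Type w) (_ : NormedAddCommGroup Y) (_ : NormedSpace 𝕜 Y) (_ : CompleteSpace Y)
    (T : Y →L[𝕜] X) (y : ℕ → Y),
    𝒜 Y T ∧ Tendsto y atTop (𝓝 0) ∧ ∀ n, x n = T (y n)

/-- `𝒜`-compact sets: subsets of images under some `T ∈ 𝒜(Y, X)` of relatively compact
subsets of `Y`. -/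
def OperatorClass.CompactSet (𝒜 : OperatorClass.{u, w} 𝕜 X) (K : Set X) : Prop :=
  ∃ (Y : Type w) (_ : NormedAddCommGroup Y) (_ : NormedSpace 𝕜 Y) (_ : CompleteSpace Y)
    (T : Y →L[𝕜] X) (F : Set Y),
    𝒜 Y T ∧ IsCompact (closure F) ∧ K ⊆ T '' F

variable (𝕜 X)

/-- The class `𝒰_(p, r)` of unconditionally `(p, r)`-compact operators: the image of the closed
unit ball is relatively unconditionally `(p, r)`-compact. -/
def classU (p : ℝ) (r : ℝ≥0∞) [Fact (1 ≤ r)] : OperatorClass.{u, w} 𝕜 X :=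
  fun Y _ _ _ T => RelUncondCompact 𝕜 p r (T '' Metric.closedBall (0 : Y) 1)

/-- The class `K_q` of classical `q`-compact operators: those of the form `B A` with compact
operators `A : Y → ℓ_q` and `B : ℓ_q → X` (where `ℓ_∞` stands for `c₀`). -/
def classK (q : ℝ≥0∞) [Fact (1 ≤ q)] : OperatorClass.{u, w} 𝕜 X :=
  fun Y _ _ _ T => ∃ (A : Y →L[𝕜] ell 𝕜 q) (B : ell 𝕜 q →L[𝕜] X),
    IsCompactOperator A ∧ IsCompactOperator B ∧ T = B.comp A

end Operators

end PNull

namespace PNull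

/-! ### Finite-sum criteria for weak and unconditional `p`-summability -/

section Norms

variable {𝕜 : Type} [RCLike 𝕜] {X : Type u} [NormedAddCommGroup X] [NormedSpace 𝕜 X]

/-! An unconditionally `p`-summable sequence `z` amounts to a compact operator `a ↦ ∑ aₖ zₖ` from
`ℓ_q` to `X`, and `conv` is the image of its unit ball. One direction is `UncondSummable.exists_clm`
(tails are uniformly small, so finite-rank truncations converge in norm), the other is
`uncondSummable_of_isCompactOperator`; hence K_q operators are in U_p.

The crux is to pass from a null sequence `x` in `conv z` to null coefficients. By Dini's device, `zₖ
= cₖ z'ₖ` with `c` null and `z'` still unconditionally `p`-summable, so the operator of `z` is `B ∘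
A`, where `A` is the compact diagonal operator of `c` on `ℓ_q` and `B` is the operator of `z'`. Thus
`xₙ = B mₙ` with all `mₙ` in one compact set. Since `B mₙ → 0`, compactness forces the distance from
`mₙ` to `ker B` to tend to 0, and subtracting almost nearest kernel elements gives null `yₙ` with `B
yₙ = xₙ`.

Rescaling `z'` and `yₙ` then gives uniform nullity, and factoring the operator of `z'` once more
shows that `x` is K_q-null. The way back to relative compactness needs only scaling, and, for
unconditionally null sequences, finitely many prepended terms. -/

theorem weakNorm_le_ofReal_iff {p : ℝ} (hp : 0 < p) {C : ℝ} (hC : 0 ≤ C) (z : ℕ → X) :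
    weakNorm 𝕜 p z ≤ ENNReal.ofReal C ↔
      ∀ f : StrongDual 𝕜 X, ‖f‖ ≤ 1 → ∀ s : Finset ℕ, ∑ k ∈ s, ‖f (z k)‖ ^ p ≤ C ^ p := by
  unfold weakNorm
  rw [iSup₂_le_iff]
  refine forall₂_congr fun f _ => ?_
  rw [one_div, ENNReal.rpow_inv_le_iff hp, ENNReal.ofReal_rpow_of_nonneg hC hp.le,
    ENNReal.tsum_eq_iSup_sum, iSup_le_iff]
  refine forall_congr' fun s => ?_
  have : ∑ k ∈ s, ‖f (z k)‖ₑ ^ p = ENNReal.ofReal (∑ k ∈ s, ‖f (z k)‖ ^ p) := by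
    rw [ENNReal.ofReal_sum_of_nonneg fun _ _ => by positivity]
    refine Finset.sum_congr rfl fun k _ => ?_
    rw [← ofReal_norm, ENNReal.ofReal_rpow_of_nonneg (norm_nonneg _) hp.le]
  rw [this, ENNReal.ofReal_le_ofReal_iff (by positivity)]

theorem sum_norm_rpow_truncation (f : StrongDual 𝕜 X) {p : ℝ} (hp : 0 < p) (z : ℕ → X) (N : ℕ)
    (s : Finset ℕ) :
    ∑ k ∈ s, ‖f ((z - fun k => if k < N then z k else 0) k)‖ ^ p =
      ∑ k ∈ s with N ≤ k, ‖f (z k)‖ ^ p := by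
  rw [Finset.sum_filter]
  refine Finset.sum_congr rfl fun k _ => ?_
  by_cases h : k < N
  · simp [h, Real.zero_rpow hp.ne']
  · simp [h, not_lt.1 h]

/-- Unconditional `p`-summability in terms of finite sums over remote index sets. -/
theorem uncondSummable_iff {p : ℝ} (hp : 0 < p) (z : ℕ → X) :
    UncondSummable 𝕜 p z ↔ ∀ ε : ℝ, 0 < ε → ∃ N : ℕ, ∀ f : StrongDual 𝕜 X, ‖f‖ ≤ 1 →
      ∀ s : Finset ℕ, (∀ k ∈ s, N ≤ k) → ∑ k ∈ s, ‖f (z k)‖ ^ p ≤ ε := by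
  constructor
  · rintro ⟨-, h⟩ ε hε
    have hε' : 0 < ε ^ p⁻¹ := by positivity
    obtain ⟨N, hN⟩ := (h.eventually_le_const (ENNReal.ofReal_pos.2 hε')).exists
    refine ⟨N, fun f hf s hs => ?_⟩
    have := (weakNorm_le_ofReal_iff hp hε'.le _).1 hN f hf s
    rwa [sum_norm_rpow_truncation f hp, Real.rpow_inv_rpow hε.le hp.ne',
      Finset.filter_true_of_mem hs] at this
  · intro h
    constructor
    · intro f
      obtain ⟨N, hN⟩ := h 1 one_pos
      rw [← summable_nat_add_iff N]
      -- The added 1 keeps the normalising constant nonzero when `f = 0`.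
      set c : ℝ := ‖f‖ + 1
      have hc : 0 < c := by positivity
      refine summable_of_sum_le (c := c ^ p) (fun _ => by positivity) fun s => ?_
      have hg : ‖((c : 𝕜)⁻¹ • f : StrongDual 𝕜 X)‖ ≤ 1 := by
        rw [norm_smul, norm_inv, RCLike.norm_ofReal, abs_of_pos hc, inv_mul_le_iff₀ hc]
        simp [c]
      have := hN _ hg (s.map (addRightEmbedding N)) (by simp)
      rw [Finset.sum_map] at this
      calc ∑ k ∈ s, ‖f (z (k + N))‖ ^ p
          = c ^ p * ∑ k ∈ s, ‖((c : 𝕜)⁻¹ • f : StrongDual 𝕜 X) (z (k + N))‖ ^ p := by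
            rw [Finset.mul_sum]
            refine Finset.sum_congr rfl fun k _ => ?_
            rw [← Real.mul_rpow hc.le (norm_nonneg _)]
            simp only [smul_apply, norm_smul, norm_inv, RCLike.norm_ofReal,
              abs_of_pos hc]
            rw [mul_inv_cancel_left₀ hc.ne']
        _ ≤ c ^ p * 1 := by gcongr; exact this
        _ = c ^ p := mul_one _
    · rw [ENNReal.tendsto_atTop_zero]
      intro ε hε
      rcases eq_or_ne ε ∞ with rfl | hε'
      · exact ⟨0, fun _ _ => le_top⟩
      have hr : 0 < ε.toReal := ENNReal.toReal_pos hε.ne' hε'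
      obtain ⟨N, hN⟩ := h (ε.toReal ^ p) (by positivity)
      refine ⟨N, fun n hn => ?_⟩
      rw [← ENNReal.ofReal_toReal hε', weakNorm_le_ofReal_iff hp hr.le]
      intro f hf s
      rw [sum_norm_rpow_truncation f hp]
      exact hN f hf _ fun k hk => hn.trans (Finset.mem_filter.1 hk).2

/-- A sequence which is unconditionally `p`-summable has bounded finite sums. -/
theorem UncondSummable.exists_bound {p : ℝ} (hp : 0 < p) {z : ℕ → X}
    (hz : UncondSummable 𝕜 p z) : ∃ C : ℝ, 0 < C ∧ ∀ f : StrongDual 𝕜 X, ‖f‖ ≤ 1 →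
      ∀ s : Finset ℕ, ∑ k ∈ s, ‖f (z k)‖ ^ p ≤ C ^ p := by
  obtain ⟨N, hN⟩ := (uncondSummable_iff hp z).1 hz 1 one_pos
  have h0 : 0 ≤ ∑ k ∈ Finset.range N, ‖z k‖ ^ p := by positivity
  have h1 : 0 < ∑ k ∈ Finset.range N, ‖z k‖ ^ p + 1 := by positivity
  -- The head contributes at most the sum of the `‖z k‖ ^ p`, the tail at most 1.
  refine ⟨(∑ k ∈ Finset.range N, ‖z k‖ ^ p + 1) ^ p⁻¹, by positivity, fun f hf s => ?_⟩
  rw [Real.rpow_inv_rpow h1.le hp.ne', ← Finset.sum_filter_add_sum_filter_not s (fun k => k < N)]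
  refine add_le_add ?_ (hN f hf _ (by simp))
  refine (Finset.sum_le_sum_of_subset_of_nonneg (t := Finset.range N) (fun k => by simp)
    fun _ _ _ => by positivity).trans ?_
  gcongr with k
  exact (f.le_of_opNorm_le hf _).trans_eq (one_mul _)

theorem UncondSummable.const_smul {p : ℝ} (hp : 0 < p) {z : ℕ → X}
    (hz : UncondSummable 𝕜 p z) (c : 𝕜) : UncondSummable 𝕜 p fun k => c • z k := by
  rw [uncondSummable_iff hp] at hz ⊢
  intro ε hε
  obtain ⟨N, hN⟩ := hz (ε / (‖c‖ ^ p + 1)) (by positivity)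
  refine ⟨N, fun f hf s hs => ?_⟩
  have h := hN f hf s hs
  rw [le_div_iff₀ (by positivity)] at h
  calc ∑ k ∈ s, ‖f (c • z k)‖ ^ p = (∑ k ∈ s, ‖f (z k)‖ ^ p) * ‖c‖ ^ p := by
        rw [Finset.sum_mul]
        refine Finset.sum_congr rfl fun k _ => ?_
        rw [map_smul, norm_smul, Real.mul_rpow (norm_nonneg _) (norm_nonneg _), mul_comm]
    _ ≤ (∑ k ∈ s, ‖f (z k)‖ ^ p) * (‖c‖ ^ p + 1) := by
        gcongr; simp
    _ ≤ ε := h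

end Norms

/-! ### The space `ℓ_q` (with `c₀` for `q = ∞`) and its Hölder duality -/

section Ell

variable {𝕜 : Type} [RCLike 𝕜] {q : ℝ≥0∞} [Fact (1 ≤ q)]

theorem toReal_pos_of_ne_top (hq : q ≠ ∞) : 0 < q.toReal :=
  ENNReal.toReal_pos (zero_lt_one.trans_le Fact.out).ne' hq

theorem ell.norm_apply_le (a : ell 𝕜 q) (k : ℕ) : ‖a.1 k‖ ≤ ‖a‖ :=
  lp.norm_apply_le_norm (zero_lt_one.trans_le Fact.out).ne' a.1 k

theorem ell.sum_rpow_le (hq : q ≠ ∞) (a : ell 𝕜 q) (s : Finset ℕ) :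
    ∑ k ∈ s, ‖a.1 k‖ ^ q.toReal ≤ ‖a‖ ^ q.toReal :=
  lp.sum_rpow_le_norm_rpow (toReal_pos_of_ne_top hq) a.1 s

theorem ell.ext {a b : ell 𝕜 q} (h : ∀ k, a.1 k = b.1 k) : a = b :=
  Subtype.ext (lp.ext (funext h))

/-- Builds vectors of `ℓ_q` uniformly in `q`; the `c₀` convention costs an extra null condition at
`q = ∞`. -/
theorem ell.exists_of_bound (b : ℕ → 𝕜) {C : ℝ} (hC : 0 ≤ C)
    (h_fin : q ≠ ∞ → ∀ s : Finset ℕ, ∑ k ∈ s, ‖b k‖ ^ q.toReal ≤ C ^ q.toReal)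
    (h_top : q = ∞ → (∀ k, ‖b k‖ ≤ C) ∧ Tendsto b atTop (𝓝 0)) :
    ∃ a : ell 𝕜 q, (∀ k, a.1 k = b k) ∧ ‖a‖ ≤ C := by
  by_cases hq : q = ∞
  · subst hq
    obtain ⟨h1, h2⟩ := h_top rfl
    have hm : Memℓp b ∞ := memℓp_infty ⟨C, by rintro _ ⟨k, rfl⟩; exact h1 k⟩
    exact ⟨⟨⟨b, hm⟩, fun _ => h2⟩, fun _ => rfl, lp.norm_le_of_forall_le hC h1⟩
  · have hm : Memℓp b q := memℓp_gen' (h_fin hq)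
    exact ⟨⟨⟨b, hm⟩, fun h => absurd h hq⟩, fun _ => rfl,
      lp.norm_le_of_forall_sum_le (toReal_pos_of_ne_top hq) hC (h_fin hq)⟩

/-- A uniform limit of null sequences is null. The resulting completeness allows `ℓ_q` to serve both
as domain and as target space. -/
theorem ell.isClosed : IsClosed (ell 𝕜 q : Set (lp (fun _ : ℕ => 𝕜) q)) := by
  rw [← isSeqClosed_iff_isClosed]
  intro a b ha hab hq
  rw [Metric.tendsto_atTop] at hab ⊢
  intro ε hε
  obtain ⟨n, hn⟩ := hab (ε / 2) (half_pos hε)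
  obtain ⟨N, hN⟩ := Metric.tendsto_atTop.1 (ha n hq) (ε / 2) (half_pos hε)
  refine ⟨N, fun k hk => ?_⟩
  have h1 := hN k hk
  have h2 := (lp.norm_apply_le_norm (zero_lt_one.trans_le Fact.out).ne' (a n - b) k).trans_lt
    ((dist_eq_norm _ _).symm.trans_lt (hn n le_rfl))
  rw [dist_zero_right] at h1 ⊢
  calc ‖b k‖ = ‖a n k - (a n - b) k‖ := by simp
    _ ≤ ‖a n k‖ + ‖(a n - b) k‖ := norm_sub_le _ _
    _ < ε := by linarith

instance : CompleteSpace (ell 𝕜 q) := (ell.isClosed (𝕜 := 𝕜) (q := q)).completeSpace_coe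

/-- The `k`-th unit vector of `ℓ_q`. -/
noncomputable def ell.unit (𝕜 : Type) [RCLike 𝕜] (q : ℝ≥0∞) [Fact (1 ≤ q)] (k : ℕ) : ell 𝕜 q :=
  ⟨lp.single q k 1, fun _ => tendsto_nhds_of_eventually_eq <| by
    filter_upwards [eventually_gt_atTop k] with j hj
    exact lp.single_apply_ne q k _ hj.ne'⟩

theorem ell.unit_apply (k j : ℕ) : (ell.unit 𝕜 q k).1 j = if j = k then 1 else 0 := by
  rw [ell.unit, lp.single_apply, Pi.single_apply]

theorem ell.norm_unit (k : ℕ) : ‖ell.unit 𝕜 q k‖ ≤ 1 := by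
  have h := lp.norm_single (p := q) (E := fun _ : ℕ => 𝕜) (zero_lt_one.trans_le Fact.out) k 1
  rw [norm_one] at h
  exact h.le

/-- The `k`-th coordinate functional of `ℓ_q`. -/
noncomputable def ell.coord (𝕜 : Type) [RCLike 𝕜] (q : ℝ≥0∞) [Fact (1 ≤ q)] (k : ℕ) :
    ell 𝕜 q →L[𝕜] 𝕜 :=
  (lp.evalCLM 𝕜 (fun _ : ℕ => 𝕜) q k).comp (ell 𝕜 q).subtypeL

theorem ell.coord_apply (k : ℕ) (a : ell 𝕜 q) : ell.coord 𝕜 q k a = a.1 k := rfl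

theorem ell.sum_smul_unit_apply (s : Finset ℕ) (α : ℕ → 𝕜) (j : ℕ) :
    (∑ k ∈ s, α k • ell.unit 𝕜 q k).1 j = if j ∈ s then α j else 0 := by
  rw [← ell.coord_apply, map_sum]
  simp [ell.coord_apply, ell.unit_apply]

theorem holderConjugate_cases {p : ℝ} (hp : 1 ≤ p)
    (hpq : ENNReal.HolderConjugate (ENNReal.ofReal p) q) :
    (p = 1 ∧ q = ∞) ∨ (q ≠ ∞ ∧ p.HolderConjugate q.toReal) := by
  rcases hp.eq_or_lt with rfl | hp
  · left
    refine ⟨rfl, ?_⟩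
    have := ENNReal.holderConjugate_iff.1 hpq
    rw [ENNReal.ofReal_one, inv_one] at this
    have h : q⁻¹ = 0 := (ENNReal.add_right_inj ENNReal.one_ne_top).1 (this.trans (add_zero 1).symm)
    exact ENNReal.inv_eq_zero.1 h
  · right
    have h0 : (ENNReal.ofReal p).toReal = p := ENNReal.toReal_ofReal (by linarith)
    have h1 := ENNReal.HolderConjugate.toReal (p := ENNReal.ofReal p) (q := q) (by rwa [h0])
    rw [h0] at h1
    refine ⟨?_, h1⟩
    rintro rfl
    simpa using h1.symm.pos

theorem ell.norm_sum_mul_le {p : ℝ} (hp : 1 ≤ p)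
    (hpq : ENNReal.HolderConjugate (ENNReal.ofReal p) q) (a : ell 𝕜 q) (c : ℕ → 𝕜) {C : ℝ}
    (hC : 0 ≤ C) (s : Finset ℕ) (h : ∑ k ∈ s, ‖c k‖ ^ p ≤ C ^ p) :
    ‖∑ k ∈ s, a.1 k * c k‖ ≤ ‖a‖ * C := by
  refine (norm_sum_le _ _).trans ?_
  simp_rw [norm_mul]
  rcases holderConjugate_cases hp hpq with ⟨rfl, rfl⟩ | ⟨hq, hpq⟩
  · simp only [Real.rpow_one] at h
    calc ∑ k ∈ s, ‖a.1 k‖ * ‖c k‖ ≤ ∑ k ∈ s, ‖a‖ * ‖c k‖ := by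
          gcongr; exact ell.norm_apply_le _ _
      _ = ‖a‖ * ∑ k ∈ s, ‖c k‖ := by rw [Finset.mul_sum]
      _ ≤ _ := by gcongr
  · have hq0 := hpq.symm.pos
    refine (Real.inner_le_Lp_mul_Lq s _ _ hpq.symm).trans ?_
    simp only [abs_norm, one_div]
    gcongr
    · rw [Real.rpow_inv_le_iff_of_pos (by positivity) (by positivity) hq0]
      exact ell.sum_rpow_le hq a s
    · rwa [Real.rpow_inv_le_iff_of_pos (by positivity) hC hpq.pos]

/-- The equality case of Hölder: with `S = ∑ ‖c k‖ ^ p`, take `αₖ = σₖ ‖cₖ‖ ^ (p - 1) S ^ (1/p -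
1)`, where the sign `σₖ` turns `cₖ` into `‖cₖ‖`. For `q < ∞` the norm bound follows from `(p - 1) q
= p` and `(1/p - 1) q = -1`; for `q = ∞` the entries are signs, and finite support puts the vector
in `c₀`. -/
theorem ell.exists_dual_vector {p : ℝ} (hp : 1 ≤ p)
    (hpq : ENNReal.HolderConjugate (ENNReal.ofReal p) q) (c : ℕ → 𝕜) (s : Finset ℕ) :
    ∃ α : ℕ → 𝕜, ‖∑ k ∈ s, α k • ell.unit 𝕜 q k‖ ≤ 1 ∧
      ∑ k ∈ s, ‖c k‖ ^ p ≤ ‖∑ k ∈ s, α k * c k‖ ^ p := by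
  classical
  have hp0 : 0 < p := by linarith
  set S := ∑ k ∈ s, ‖c k‖ ^ p with hS
  have hS0 : 0 ≤ S := by positivity
  rcases hS0.eq_or_lt with h0 | hS0
  · exact ⟨0, by simp, by rw [← h0]; positivity⟩
  have hsgn : ∀ k, ∃ σ : 𝕜, ‖σ‖ ≤ 1 ∧ σ * c k = ‖c k‖ := fun k => by
    by_cases hc : c k = 0
    · exact ⟨0, by simp, by simp [hc]⟩
    · have : (‖c k‖ : 𝕜) ≠ 0 := by simpa using hc
      refine ⟨‖c k‖ / c k, ?_, div_mul_cancel₀ _ hc⟩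
      simp [div_self (norm_ne_zero_iff.2 hc)]
  choose σ hσ1 hσ using hsgn
  refine ⟨fun k => σ k * ((‖c k‖ ^ (p - 1) * S ^ (p⁻¹ - 1) : ℝ) : 𝕜), ?_, ?_⟩
  · have h_fin : q ≠ ∞ → ∀ t : Finset ℕ, ∑ k ∈ t, ‖if k ∈ s then
        σ k * ((‖c k‖ ^ (p - 1) * S ^ (p⁻¹ - 1) : ℝ) : 𝕜) else 0‖ ^ q.toReal ≤ 1 ^ q.toReal := by
      intro hq t
      rcases holderConjugate_cases hp hpq with ⟨-, rfl⟩ | ⟨-, hpq⟩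
      · exact absurd rfl hq
      have hq0 := hpq.symm.pos
      rw [Real.one_rpow]
      calc _ ≤ ∑ k ∈ t, if k ∈ s then ‖c k‖ ^ p * S⁻¹ else 0 := by
            refine Finset.sum_le_sum fun k _ => ?_
            split_ifs
            · rw [norm_mul, RCLike.norm_ofReal, abs_of_nonneg (by positivity)]
              calc _ ≤ (1 * (‖c k‖ ^ (p - 1) * S ^ (p⁻¹ - 1))) ^ q.toReal := by
                    gcongr; exact hσ1 k
                _ = _ := by
                  rw [one_mul, Real.mul_rpow (by positivity) (by positivity),
                    ← Real.rpow_mul (by positivity), ← Real.rpow_mul hS0.le, hpq.sub_one_mul_conj]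
                  congr 1
                  have := hpq.inv_add_inv_eq_one
                  have h2 : p⁻¹ - 1 = - (q.toReal)⁻¹ := by linarith
                  rw [h2, neg_mul, inv_mul_cancel₀ hq0.ne', Real.rpow_neg_one]
            · simp [Real.zero_rpow hq0.ne']
        _ = ∑ k ∈ t with k ∈ s, ‖c k‖ ^ p * S⁻¹ := by rw [Finset.sum_filter]
        _ ≤ ∑ k ∈ s, ‖c k‖ ^ p * S⁻¹ :=
            Finset.sum_le_sum_of_subset_of_nonneg (fun k => by simp) fun _ _ _ => by positivity
        _ = 1 := by rw [← Finset.sum_mul, mul_inv_cancel₀ hS0.ne']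
    have h_top : q = ∞ → (∀ k, ‖if k ∈ s then
        σ k * ((‖c k‖ ^ (p - 1) * S ^ (p⁻¹ - 1) : ℝ) : 𝕜) else 0‖ ≤ 1) ∧
        Tendsto (fun k => if k ∈ s then
          σ k * ((‖c k‖ ^ (p - 1) * S ^ (p⁻¹ - 1) : ℝ) : 𝕜) else 0) atTop (𝓝 0) := by
      rintro rfl
      rcases holderConjugate_cases hp hpq with ⟨rfl, -⟩ | ⟨h, -⟩
      · refine ⟨fun k => ?_, ?_⟩
        · split_ifs
          · simpa using hσ1 k
          · simp
        · refine tendsto_nhds_of_eventually_eq ?_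
          rw [← Nat.cofinite_eq_atTop]
          refine s.finite_toSet.subset fun k hk => ?_
          by_contra h
          exact hk (if_neg h)
      · exact absurd rfl h
    obtain ⟨b, hb, hb1⟩ := ell.exists_of_bound _ zero_le_one h_fin h_top
    convert hb1 using 2
    exact ell.ext fun k => by rw [ell.sum_smul_unit_apply, hb]
  · have : ∑ k ∈ s, σ k * ((‖c k‖ ^ (p - 1) * S ^ (p⁻¹ - 1) : ℝ) : 𝕜) * c k =
        ((S ^ p⁻¹ : ℝ) : 𝕜) := by
      have h1 : S ^ p⁻¹ = ∑ k ∈ s, ‖c k‖ ^ p * S ^ (p⁻¹ - 1) := by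
        rw [← Finset.sum_mul, ← hS, ← Real.rpow_one_add' hS0.le (by simp [hp0.ne'])]
        congr 1; ring
      rw [h1, RCLike.ofReal_sum]
      refine Finset.sum_congr rfl fun k _ => ?_
      rw [mul_right_comm, hσ, ← RCLike.ofReal_mul, ← mul_assoc]
      congr 2
      rw [← Real.rpow_one_add' (norm_nonneg _) (by linarith)]
      congr 1; ring
    rw [this, RCLike.norm_ofReal, abs_of_nonneg (by positivity), Real.rpow_inv_rpow hS0.le hp0.ne']

end Ell

/-! ### Unconditionally `p`-summable sequences and compact operators on `ℓ_q` -/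

section Synthesis

variable {𝕜 : Type} [RCLike 𝕜] {X : Type u} [NormedAddCommGroup X] [NormedSpace 𝕜 X]
  {q : ℝ≥0∞} [Fact (1 ≤ q)] {p : ℝ}

/-- Apply a norming functional to the sum, then Hölder. -/
theorem norm_sum_smul_le (hp : 1 ≤ p) (hpq : ENNReal.HolderConjugate (ENNReal.ofReal p) q)
    (a : ell 𝕜 q) (z : ℕ → X) {C : ℝ} (hC : 0 ≤ C) (s : Finset ℕ)
    (h : ∀ f : StrongDual 𝕜 X, ‖f‖ ≤ 1 → ∑ k ∈ s, ‖f (z k)‖ ^ p ≤ C ^ p) :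
    ‖∑ k ∈ s, a.1 k • z k‖ ≤ ‖a‖ * C := by
  obtain ⟨f, hf, hfx⟩ := exists_dual_vector'' 𝕜 (∑ k ∈ s, a.1 k • z k)
  have := ell.norm_sum_mul_le hp hpq a (fun k => f (z k)) hC s (h f hf)
  have h2 : f (∑ k ∈ s, a.1 k • z k) = ∑ k ∈ s, a.1 k * f (z k) := by simp
  rwa [← h2, hfx, RCLike.norm_ofReal, abs_norm] at this

theorem UncondSummable.exists_clm [CompleteSpace X] (hp : 1 ≤ p)
    (hpq : ENNReal.HolderConjugate (ENNReal.ofReal p) q) {z : ℕ → X}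
    (hz : UncondSummable 𝕜 p z) :
    ∃ B : ell 𝕜 q →L[𝕜] X, IsCompactOperator B ∧
      ∀ a : ell 𝕜 q, HasSum (fun k => a.1 k • z k) (B a) := by
  have hp0 : 0 < p := by linarith
  have tail : ∀ ε : ℝ, 0 < ε → ∃ N : ℕ, ∀ (a : ell 𝕜 q) (s : Finset ℕ), (∀ k ∈ s, N ≤ k) →
      ‖∑ k ∈ s, a.1 k • z k‖ ≤ ‖a‖ * ε := by
    intro ε hε
    obtain ⟨N, hN⟩ := (uncondSummable_iff hp0 z).1 hz (ε ^ p) (by positivity)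
    exact ⟨N, fun a s hs => norm_sum_smul_le hp hpq a z hε.le s fun f hf => hN f hf s hs⟩
  have hsum : ∀ a : ell 𝕜 q, Summable fun k => a.1 k • z k := by
    intro a
    rw [summable_iff_vanishing_norm]
    intro ε hε
    obtain ⟨N, hN⟩ := tail (ε / (‖a‖ + 1)) (by positivity)
    refine ⟨Finset.range N, fun t ht => (hN a t fun k hk => ?_).trans_lt ?_⟩
    · by_contra h
      exact Finset.disjoint_left.1 ht hk (Finset.mem_range.2 (not_le.1 h))
    · rw [mul_div_assoc', div_lt_iff₀ (by positivity), mul_comm]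
      gcongr
      simp
  obtain ⟨C, hC, hbound⟩ := hz.exists_bound hp0
  let B : ell 𝕜 q →L[𝕜] X := LinearMap.mkContinuous
    { toFun := fun a => ∑' k, a.1 k • z k
      map_add' := fun a b => by
        rw [← (hsum a).tsum_add (hsum b)]
        simp [add_smul]
      map_smul' := fun c a => by
        rw [RingHom.id_apply, ← (hsum a).tsum_const_smul c]
        simp [mul_smul] } C fun a => by
      rw [mul_comm]
      exact le_of_tendsto (hsum a).hasSum.norm <| Eventually.of_forall fun s =>
        norm_sum_smul_le hp hpq a z hC.le s fun f hf => hbound f hf s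
  have hB : ∀ a : ell 𝕜 q, HasSum (fun k => a.1 k • z k) (B a) := fun a => (hsum a).hasSum
  refine ⟨B, ?_, hB⟩
  let F : ℕ → ell 𝕜 q →L[𝕜] X := fun N =>
    ∑ k ∈ Finset.range N, (ell.coord 𝕜 q k).smulRight (z k)
  have hF : ∀ N a, F N a = ∑ k ∈ Finset.range N, a.1 k • z k := fun N a => by
    simp [F, ell.coord_apply]
  -- The tail estimate is linear in `‖a‖`, so the finite-rank truncations converge to `B` in
  -- operator norm.
  refine isCompactOperator_of_tendsto (l := atTop) (F := F) ?_ (Eventually.of_forall fun N => ?_)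
  · refine (tendsto_iff_norm_sub_tendsto_zero (E := ell 𝕜 q →L[𝕜] X)).2 ?_
    rw [Metric.tendsto_atTop]
    intro ε hε
    obtain ⟨N, hN⟩ := tail (ε / 2) (half_pos hε)
    refine ⟨N, fun n hn => ?_⟩
    rw [dist_zero_right, norm_norm]
    refine (ContinuousLinearMap.opNorm_le_bound _ (half_pos hε).le fun a => ?_).trans_lt
      (half_lt_self hε)
    rw [mul_comm]
    refine le_of_tendsto ((hB a).const_sub (F n a)).norm ?_
    filter_upwards [eventually_ge_atTop (Finset.range n)] with s hs
    rw [hF, norm_sub_rev, ← Finset.sum_sdiff hs, add_sub_cancel_right]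
    refine hN a _ fun k hk => hn.trans ?_
    simpa using (Finset.mem_sdiff.1 hk).2
  · have : ∀ s : Finset ℕ,
        IsCompactOperator (∑ k ∈ s, (ell.coord 𝕜 q k).smulRight (z k) : ell 𝕜 q →L[𝕜] X) := by
      intro s
      induction s using Finset.induction_on with
      | empty => exact isCompactOperator_zero
      | insert k s hk ih =>
        rw [Finset.sum_insert hk]
        refine IsCompactOperator.add ?_ ih
        have h : IsCompactOperator (ContinuousLinearMap.toSpanSingleton 𝕜 (z k)) :=
          isCompactOperator_of_locallyCompactSpace_rng (ContinuousLinearMap.toSpanSingleton 𝕜 (z k))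
        exact h.comp_clm (ell.coord 𝕜 q k)
    exact this _

theorem sum_norm_apply_unit_le (hp : 1 ≤ p) (hpq : ENNReal.HolderConjugate (ENNReal.ofReal p) q)
    (g : StrongDual 𝕜 (ell 𝕜 q)) (s : Finset ℕ) :
    ∑ k ∈ s, ‖g (ell.unit 𝕜 q k)‖ ^ p ≤ ‖g‖ ^ p := by
  obtain ⟨α, hα, h⟩ := ell.exists_dual_vector hp hpq (fun k => g (ell.unit 𝕜 q k)) s
  refine h.trans ?_
  gcongr
  have : ∑ k ∈ s, α k * g (ell.unit 𝕜 q k) = g (∑ k ∈ s, α k • ell.unit 𝕜 q k) := by simp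
  rw [this]
  exact g.unit_le_opNorm _ hα

/-- A compact operator on `ℓ_q` maps the unit vectors to an unconditionally `p`-summable
sequence. -/
theorem uncondSummable_of_isCompactOperator (hp : 1 ≤ p)
    (hpq : ENNReal.HolderConjugate (ENNReal.ofReal p) q) (B : ell 𝕜 q →L[𝕜] X)
    (hB : IsCompactOperator B) : UncondSummable 𝕜 p fun k => B (ell.unit 𝕜 q k) := by
  have hp0 : 0 < p := by linarith
  rw [uncondSummable_iff hp0]
  -- Otherwise, for every `N` there is a vector `a N` of the unit ball, supported beyond `N`, with
  -- `‖B (a N)‖` bounded below. Compactness gives a norm limit of a subsequence, which must be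
  -- nonzero.
  by_contra! hcon
  obtain ⟨ε, hε, hcon⟩ := hcon
  choose f hf s hs hfs using hcon
  choose α hα hαs using fun N => ell.exists_dual_vector hp hpq
    (fun k => f N (B (ell.unit 𝕜 q k))) (s N)
  set a : ℕ → ell 𝕜 q := fun N => ∑ k ∈ s N, α N k • ell.unit 𝕜 q k with ha
  have hlow : ∀ N, ε ^ p⁻¹ ≤ ‖B (a N)‖ := by
    intro N
    have h1 : ∑ k ∈ s N, α N k * f N (B (ell.unit 𝕜 q k)) = f N (B (a N)) := by simp [ha]
    rw [Real.rpow_inv_le_iff_of_pos hε.le (norm_nonneg _) hp0]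
    refine ((hfs N).le.trans (hαs N)).trans ?_
    rw [h1]
    gcongr
    exact ((f N).le_of_opNorm_le (hf N) _).trans_eq (one_mul _)
  obtain ⟨K, hK, hKB⟩ := IsCompactOperator.image_closedBall_subset_compact
    (f := (B : ell 𝕜 q →ₗ[𝕜] X)) hB 1
  obtain ⟨y, -, φ, hφ, hy⟩ := hK.tendsto_subseq (x := fun N => B (a N)) fun N =>
    hKB ⟨a N, mem_closedBall_zero_iff.2 (hα N), rfl⟩
  -- The limit vanishes because the images are weakly null: `g (B eₖ)` is in `ℓ_p`, so Hölder on the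
  -- remote block `s N` makes `g (B (a N))` small.
  have hy0 : y = 0 := by
    rw [SeparatingDual.eq_zero_iff_forall_dual_eq_zero (R := 𝕜)]
    intro g
    have h1 : Tendsto (fun n => g (B (a (φ n)))) atTop (𝓝 (g y)) :=
      (g.continuous.tendsto y).comp hy
    refine tendsto_nhds_unique h1 (Tendsto.comp (g := fun N => g (B (a N))) ?_ hφ.tendsto_atTop)
    have hsum : Summable fun k => ‖g (B (ell.unit 𝕜 q k))‖ ^ p :=
      summable_of_sum_le (fun _ => by positivity) fun t =>
        sum_norm_apply_unit_le hp hpq (g.comp B) t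
    rw [Metric.tendsto_atTop]
    intro δ hδ
    obtain ⟨t, ht⟩ := summable_iff_vanishing_norm.1 hsum ((δ / 2) ^ p) (by positivity)
    obtain ⟨N, hN⟩ := t.exists_nat_subset_range
    refine ⟨N, fun n hn => ?_⟩
    have hdis : Disjoint (s n) t := by
      rw [Finset.disjoint_left]
      intro k hk hkt
      exact absurd (Finset.mem_range.1 (hN hkt)) (not_lt.2 (hn.trans (hs n k hk)))
    have h2 := ht (s n) hdis
    rw [Real.norm_of_nonneg (by positivity)] at h2
    have h3 := ell.norm_sum_mul_le hp hpq (a n) (fun k => g (B (ell.unit 𝕜 q k)))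
      (half_pos hδ).le (s n) h2.le
    have h4 : ∑ k ∈ s n, (a n).1 k * g (B (ell.unit 𝕜 q k)) = g (B (a n)) := by
      conv_rhs => rw [ha]
      simp only [map_sum, map_smul, smul_eq_mul]
      refine Finset.sum_congr rfl fun k hk => ?_
      rw [ha, ell.sum_smul_unit_apply, if_pos hk]
    rw [dist_zero_right, ← h4]
    calc _ ≤ ‖a n‖ * (δ / 2) := h3
      _ ≤ 1 * (δ / 2) := by gcongr; exact hα n
      _ < δ := by linarith
  have h1 := ge_of_tendsto hy.norm (Eventually.of_forall fun n => hlow (φ n))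
  rw [hy0, norm_zero] at h1
  exact absurd h1 (not_le.2 (by positivity))

theorem ell.hasSum_unit (a : ell 𝕜 q) : HasSum (fun k => a.1 k • ell.unit 𝕜 q k) a := by
  by_cases hq : q = ∞
  · subst hq
    refine Metric.tendsto_atTop.2 fun ε hε => ?_
    obtain ⟨N, hN⟩ := Metric.tendsto_atTop.1 (a.2 rfl) (ε / 2) (half_pos hε)
    refine ⟨Finset.range N, fun s hs => ?_⟩
    rw [dist_comm, dist_eq_norm]
    refine (lp.norm_le_of_forall_le (half_pos hε).le fun k => ?_).trans_lt (half_lt_self hε)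
    change ‖a.1 k - (∑ k ∈ s, a.1 k • ell.unit 𝕜 ∞ k).1 k‖ ≤ ε / 2
    rw [ell.sum_smul_unit_apply s (fun k => a.1 k)]
    split_ifs with h
    · simpa using (half_pos hε).le
    · have hk : N ≤ k := by
        by_contra hk
        exact h (hs (Finset.mem_range.2 (not_le.1 hk)))
      simpa using (hN k hk).le
  · have h := lp.hasSum_single hq a.1
    refine tendsto_subtype_rng.2 (h.congr' (Eventually.of_forall fun s => ?_))
    refine Eq.trans ?_ (map_sum (ell 𝕜 q).subtype (fun k => a.1 k • ell.unit 𝕜 q k) s).symm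
    refine Finset.sum_congr rfl fun k _ => ?_
    change _ = a.1 k • lp.single (E := fun _ : ℕ => 𝕜) q k 1
    rw [← lp.single_smul, smul_eq_mul, mul_one]

end Synthesis

/-! ### Splitting off a null factor -/

section Factorization

/-- Dini's estimate: dividing a nonnegative series by the square roots of bounds for its
remainders leaves a convergent series. -/
theorem sum_div_sqrt_tail_le {c τ : ℕ → ℝ} (hc : ∀ k, 0 ≤ c k)
    (h : ∀ (N : ℕ) (s : Finset ℕ), (∀ k ∈ s, N ≤ k) → ∑ k ∈ s, c k ≤ τ N) (N : ℕ)
    (s : Finset ℕ) (hs : ∀ k ∈ s, N ≤ k) :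
    ∑ k ∈ s, c k / √(τ k) ≤ 2 * √(τ N) := by
  have hsum : Summable c := summable_of_sum_le hc fun s => h 0 s (by simp)
  set r : ℕ → ℝ := fun N => ∑' k, c (k + N)
  have hsumN : ∀ N, Summable fun k => c (k + N) := fun N => (summable_nat_add_iff N).2 hsum
  have hr0 : ∀ N, 0 ≤ r N := fun N => tsum_nonneg fun _ => hc _
  have hrτ : ∀ N, r N ≤ τ N := fun N =>
    (hsumN N).tsum_le_of_sum_le fun t => by
      have := h N (t.map (addRightEmbedding N)) (by simp)
      simpa [Finset.sum_map] using this
  have hstep : ∀ N, r N = c N + r (N + 1) := fun N => by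
    simp only [r]
    rw [(hsumN N).tsum_eq_zero_add, zero_add]
    simp only [add_assoc, add_comm 1 N]
  -- Write `c k = r k - r (k + 1)` as a difference of squares of roots; the sum of the two roots is
  -- at most `2 √(r k)`, and the bound telescopes.
  have hterm : ∀ k, c k / √(τ k) ≤ 2 * (√(r k) - √(r (k + 1))) := by
    intro k
    have hle : √(r (k + 1)) ≤ √(r k) := Real.sqrt_le_sqrt (by linarith [hstep k, hc k])
    rcases (Real.sqrt_nonneg (r k)).eq_or_lt with h0 | h0
    · have h1 : r k = 0 := (Real.sqrt_eq_zero (hr0 k)).1 h0.symm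
      have h2 : c k = 0 := by linarith [hstep k, hc k, hr0 (k + 1)]
      rw [h2, zero_div]
      linarith
    · calc c k / √(τ k) ≤ c k / √(r k) :=
            div_le_div_of_nonneg_left (hc k) h0 (Real.sqrt_le_sqrt (hrτ k))
        _ ≤ 2 * (√(r k) - √(r (k + 1))) := by
            rw [div_le_iff₀ h0]
            nlinarith [Real.sq_sqrt (hr0 k), Real.sq_sqrt (hr0 (k + 1)), hstep k,
              Real.sqrt_nonneg (r (k + 1))]
  obtain ⟨M, hM⟩ := s.exists_nat_subset_range
  have hsub : s ⊆ Finset.Ico N (max N M) := fun k hk => Finset.mem_Ico.2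
    ⟨hs k hk, lt_max_of_lt_right (Finset.mem_range.1 (hM hk))⟩
  calc ∑ k ∈ s, c k / √(τ k)
      ≤ ∑ k ∈ Finset.Ico N (max N M), c k / √(τ k) :=
        Finset.sum_le_sum_of_subset_of_nonneg hsub fun k _ _ =>
          div_nonneg (hc k) (Real.sqrt_nonneg _)
    _ ≤ ∑ k ∈ Finset.Ico N (max N M), 2 * (√(r k) - √(r (k + 1))) :=
        Finset.sum_le_sum fun k _ => hterm k
    _ = 2 * (√(r N) - √(r (max N M))) := by
        rw [← Finset.mul_sum, ← neg_sub (√(r (max N M))),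
          ← Finset.sum_Ico_sub (fun k => √(r k)) (le_max_left N M), ← Finset.sum_neg_distrib]
        simp
    _ ≤ 2 * √(τ N) := by
        have := Real.sqrt_le_sqrt (hrτ N)
        have := Real.sqrt_nonneg (r (max N M))
        linarith

variable {𝕜 : Type} [RCLike 𝕜] {X : Type u} [NormedAddCommGroup X] [NormedSpace 𝕜 X]
  {q : ℝ≥0∞} [Fact (1 ≤ q)] {p : ℝ}

/-- One `τ` serves all functionals, so the weights built from it do not depend on `f`. -/
theorem UncondSummable.exists_tail_bound (hp : 0 < p) {z : ℕ → X} (hz : UncondSummable 𝕜 p z) :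
    ∃ τ : ℕ → ℝ, Tendsto τ atTop (𝓝 0) ∧ ∀ f : StrongDual 𝕜 X, ‖f‖ ≤ 1 →
      ∀ (N : ℕ) (s : Finset ℕ), (∀ k ∈ s, N ≤ k) → ∑ k ∈ s, ‖f (z k)‖ ^ p ≤ τ N := by
  obtain ⟨C, hC, hCz⟩ := hz.exists_bound hp
  set t : ℕ → ℝ≥0∞ := fun N => weakNorm 𝕜 p (z - fun k => if k < N then z k else 0)
  have ht : ∀ N, t N ≠ ∞ := fun N => by
    refine ne_top_of_le_ne_top ENNReal.ofReal_ne_top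
      ((weakNorm_le_ofReal_iff hp hC.le _).2 fun f hf s => ?_)
    rw [sum_norm_rpow_truncation f hp]
    exact hCz f hf _
  refine ⟨fun N => (t N).toReal ^ p, ?_, fun f hf N s hs => ?_⟩
  · have h := (ENNReal.tendsto_toReal ENNReal.zero_ne_top).comp hz.2
    rw [ENNReal.toReal_zero] at h
    simpa [Real.zero_rpow hp.ne'] using h.rpow_const (p := p) (Or.inr hp.le)
  · have h := (weakNorm_le_ofReal_iff hp ENNReal.toReal_nonneg _).1
      (ENNReal.ofReal_toReal (ht N)).ge f hf s
    rwa [sum_norm_rpow_truncation f hp, Finset.filter_true_of_mem hs] at h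

/-- An unconditionally `p`-summable sequence is the product of a null sequence of scalars and an
unconditionally `p`-summable sequence. -/
theorem UncondSummable.exists_null_smul (hp : 0 < p) {z : ℕ → X} (hz : UncondSummable 𝕜 p z) :
    ∃ (c : ℕ → 𝕜) (z' : ℕ → X), Tendsto c atTop (𝓝 0) ∧ UncondSummable 𝕜 p z' ∧
      ∀ k, z k = c k • z' k := by
  obtain ⟨τ, hτ, hz⟩ := hz.exists_tail_bound hp
  have hτ0 : ∀ N, 0 ≤ τ N := fun N => by simpa using hz 0 (by simp) N ∅ (by simp)
  have hsqrt : Tendsto (fun k => √(τ k)) atTop (𝓝 0) := by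
    simpa using hτ.sqrt
  -- The exponent is chosen so that `‖f (z' k)‖ ^ p = ‖f (z k)‖ ^ p / √(τ k)`, to which Dini's
  -- estimate applies.
  refine ⟨fun k => ((√(τ k) ^ p⁻¹ : ℝ) : 𝕜),
    fun k => ((√(τ k) ^ p⁻¹ : ℝ) : 𝕜)⁻¹ • z k, ?_, ?_, fun k => ?_⟩
  · have h := hsqrt.rpow_const (p := p⁻¹) (Or.inr (inv_pos.2 hp).le)
    rw [Real.zero_rpow (inv_pos.2 hp).ne'] at h
    simpa [Function.comp_def] using ((RCLike.continuous_ofReal (K := 𝕜)).tendsto 0).comp h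
  · rw [uncondSummable_iff hp]
    intro ε hε
    obtain ⟨N, hN⟩ := (hsqrt.eventually_le_const (half_pos hε)).exists
    refine ⟨N, fun f hf s hs => ?_⟩
    calc _ = ∑ k ∈ s, ‖f (z k)‖ ^ p / √(τ k) := by
          refine Finset.sum_congr rfl fun k _ => ?_
          rw [map_smul, norm_smul, norm_inv, RCLike.norm_ofReal, abs_of_nonneg (by positivity),
            Real.mul_rpow (by positivity) (norm_nonneg _), Real.inv_rpow (by positivity),
            Real.rpow_inv_rpow (Real.sqrt_nonneg _) hp.ne', div_eq_inv_mul]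
      _ ≤ 2 * √(τ N) := sum_div_sqrt_tail_le (fun _ => by positivity) (hz f hf) N s hs
      _ ≤ ε := by linarith
  -- If `τ k = 0`, the weight and its conventional inverse are both 0, but then `z k = 0` as well.
  · by_cases hk : τ k = 0
    · obtain ⟨f, hf, hfz⟩ := exists_dual_vector'' 𝕜 (z k)
      have h := hz f hf k {k} (by simp)
      rw [Finset.sum_singleton, hk, hfz, RCLike.norm_ofReal, abs_norm] at h
      have h0 : ‖z k‖ = 0 := by
        by_contra h0
        have : 0 < ‖z k‖ := lt_of_le_of_ne (norm_nonneg _) (Ne.symm h0)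
        exact absurd h (not_le.2 (by positivity))
      simp [norm_eq_zero.1 h0]
    · have h0 : √(τ k) ^ p⁻¹ ≠ 0 := by
        have : 0 < τ k := lt_of_le_of_ne (hτ0 k) (Ne.symm hk)
        positivity
      rw [smul_inv_smul₀ (RCLike.ofReal_ne_zero.2 h0)]

/-- The unit vectors have weak `p`-norm at most 1, so a tail is controlled by the supremum of `‖c k‖
^ p` over it. -/
theorem uncondSummable_smul_unit (hp : 1 ≤ p)
    (hpq : ENNReal.HolderConjugate (ENNReal.ofReal p) q) {c : ℕ → 𝕜}
    (hc : Tendsto c atTop (𝓝 0)) : UncondSummable 𝕜 p fun k => c k • ell.unit 𝕜 q k := by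
  have hp0 : 0 < p := by linarith
  rw [uncondSummable_iff hp0]
  intro ε hε
  obtain ⟨N, hN⟩ := Metric.tendsto_atTop.1 hc (ε ^ p⁻¹) (by positivity)
  refine ⟨N, fun f hf s hs => ?_⟩
  calc ∑ k ∈ s, ‖f (c k • ell.unit 𝕜 q k)‖ ^ p
      ≤ ∑ k ∈ s, ε * ‖f (ell.unit 𝕜 q k)‖ ^ p := by
        refine Finset.sum_le_sum fun k hk => ?_
        rw [map_smul, norm_smul, Real.mul_rpow (norm_nonneg _) (norm_nonneg _)]
        gcongr
        have := (hN k (hs k hk)).le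
        rw [dist_zero_right] at this
        exact (Real.le_rpow_inv_iff_of_pos (norm_nonneg _) hε.le hp0).1 this
    _ = ε * ∑ k ∈ s, ‖f (ell.unit 𝕜 q k)‖ ^ p := by rw [Finset.mul_sum]
    _ ≤ ε * 1 := by
        gcongr
        refine (sum_norm_apply_unit_le hp hpq f s).trans ?_
        exact Real.rpow_le_one (by positivity) hf hp0.le
    _ = ε := mul_one _

/-- The operator `a ↦ ∑ aₖ zₖ` defined by an unconditionally `p`-summable sequence factors as a
product of compact operators through `ℓ_q`. -/
theorem UncondSummable.exists_compact_factorization [CompleteSpace X] (hp : 1 ≤ p)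
    (hpq : ENNReal.HolderConjugate (ENNReal.ofReal p) q) {z : ℕ → X}
    (hz : UncondSummable 𝕜 p z) :
    ∃ (A : ell 𝕜 q →L[𝕜] ell 𝕜 q) (B : ell 𝕜 q →L[𝕜] X) (z' : ℕ → X), IsCompactOperator A ∧
      IsCompactOperator B ∧ UncondSummable 𝕜 p z' ∧
      (∀ a : ell 𝕜 q, HasSum (fun k => a.1 k • z' k) (B a)) ∧
      ∀ a : ell 𝕜 q, HasSum (fun k => a.1 k • z k) (B (A a)) := by
  obtain ⟨c, z', hc, hz', hzz'⟩ := hz.exists_null_smul (by linarith)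
  obtain ⟨B, hB, hBz⟩ := hz'.exists_clm hp hpq
  -- `A` is the diagonal operator of `c`, compact as the operator of the sequence `cₖ eₖ` in `ℓ_q`.
  obtain ⟨A, hA, hAc⟩ := (uncondSummable_smul_unit hp hpq hc).exists_clm hp hpq
  refine ⟨A, B, z', hA, hB, hz', hBz, fun a => ?_⟩
  have hBu : ∀ k, B (ell.unit 𝕜 q k) = z' k := fun k => by
    refine (hBz (ell.unit 𝕜 q k)).unique ?_
    convert hasSum_single k fun j hj => ?_ using 1
    · simp [ell.unit_apply]
    · simp [ell.unit_apply, hj]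
  convert (hAc a).mapL B using 2 with k
  rw [hzz', map_smul, map_smul, hBu]

end Factorization

/-! ### Lifting null sequences through an operator -/

section Lifting

variable {𝕜 : Type} [RCLike 𝕜] {X : Type u} [NormedAddCommGroup X] [NormedSpace 𝕜 X]
  {Y : Type w} [NormedAddCommGroup Y] [NormedSpace 𝕜 Y]

/-- A null sequence which is the image of a sequence in a compact set is the image of a null
sequence. -/
theorem exists_null_lift (T : Y →L[𝕜] X) {K : Set Y} (hK : IsCompact K) {m : ℕ → Y}
    (hm : ∀ n, m n ∈ K) (hT : Tendsto (fun n => T (m n)) atTop (𝓝 0)) :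
    ∃ y : ℕ → Y, Tendsto y atTop (𝓝 0) ∧ ∀ n, T (y n) = T (m n) := by
  set L : Set Y := T ⁻¹' {0} with hL
  have hL0 : L.Nonempty := ⟨0, by simp [hL]⟩
  -- Every cluster point of `m` lies in the kernel `L`, by continuity of `T`; compactness then
  -- suffices.
  have hdist : Tendsto (fun n => Metric.infDist (m n) L) atTop (𝓝 0) := by
    refine tendsto_of_subseq_tendsto fun ns hns => ?_
    obtain ⟨y, -, φ, hφ, hy⟩ := hK.tendsto_subseq (x := fun n => m (ns n)) fun n => hm _
    refine ⟨φ, ?_⟩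
    have hTy : T y = 0 := tendsto_nhds_unique ((T.continuous.tendsto y).comp hy)
      (hT.comp (hns.comp hφ.tendsto_atTop))
    have h := ((Metric.continuous_infDist_pt L).tendsto y).comp hy
    rwa [Metric.infDist_zero_of_mem (show y ∈ L from hTy)] at h
  -- The distance need not be attained, hence the vanishing slack.
  have hex : ∀ n : ℕ, ∃ l ∈ L, dist (m n) l < Metric.infDist (m n) L + 1 / ((n : ℝ) + 1) :=
    fun n => (Metric.infDist_lt_iff hL0).1 (lt_add_of_pos_right _ (by positivity))
  choose l hl hdl using hex
  refine ⟨fun n => m n - l n, ?_, fun n => ?_⟩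
  · refine squeeze_zero_norm (fun n => ?_)
      (by simpa using hdist.add tendsto_one_div_add_atTop_nhds_zero_nat)
    rw [← dist_eq_norm]
    simpa using (hdl n).le
  · have : T (l n) = 0 := hl n
    rw [map_sub, this, sub_zero]

end Lifting

/-! ### Null sequences, convex hulls and null coefficients -/

section Sequences

variable {𝕜 : Type} [RCLike 𝕜] {X : Type u} [NormedAddCommGroup X] [NormedSpace 𝕜 X]
  {q : ℝ≥0∞} [Fact (1 ≤ q)] {p : ℝ}

theorem norm_le_of_mem_conv (hp : 1 ≤ p) (hpq : ENNReal.HolderConjugate (ENNReal.ofReal p) q)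
    {z : ℕ → X} {C : ℝ} (hC : 0 ≤ C) (hz : weakNorm 𝕜 p z ≤ ENNReal.ofReal C) {x : X}
    (hx : x ∈ conv 𝕜 q z) : ‖x‖ ≤ C := by
  obtain ⟨a, ha, hax⟩ := hx
  rw [weakNorm_le_ofReal_iff (by linarith) hC] at hz
  refine le_of_tendsto hax.norm (Eventually.of_forall fun s => ?_)
  refine (norm_sum_smul_le hp hpq a z hC s fun f hf => hz f hf s).trans ?_
  calc ‖a‖ * C ≤ 1 * C := by gcongr
    _ = C := one_mul C

theorem smul_mem_conv {z : ℕ → X} {x : X} (c : 𝕜) (hx : x ∈ conv 𝕜 q z) :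
    c • x ∈ conv 𝕜 q fun k => c • z k := by
  obtain ⟨a, ha, hax⟩ := hx
  refine ⟨a, ha, ?_⟩
  simpa only [smul_comm c] using hax.const_smul c

theorem weakNorm_smul_le (hp : 0 < p) {z : ℕ → X} {C : ℝ} (hC : 0 ≤ C)
    (hz : weakNorm 𝕜 p z ≤ ENNReal.ofReal C) (c : 𝕜) :
    weakNorm 𝕜 p (fun k => c • z k) ≤ ENNReal.ofReal (‖c‖ * C) := by
  rw [weakNorm_le_ofReal_iff hp hC] at hz
  rw [weakNorm_le_ofReal_iff hp (by positivity)]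
  intro f hf s
  simp only [map_smul, norm_smul]
  calc _ = ‖c‖ ^ p * ∑ k ∈ s, ‖f (z k)‖ ^ p := by
        rw [Finset.mul_sum]
        exact Finset.sum_congr rfl fun k _ => Real.mul_rpow (norm_nonneg _) (norm_nonneg _)
    _ ≤ ‖c‖ ^ p * C ^ p := by gcongr; exact hz f hf s
    _ = _ := (Real.mul_rpow (norm_nonneg _) hC).symm

theorem UnifUncondNull.uncondNull (hp : 0 < p) {x : ℕ → X} (hx : UnifUncondNull 𝕜 p q x) :
    UncondNull 𝕜 p q x := by
  obtain ⟨z, hz, hz1, h⟩ := hx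
  intro ε hε
  obtain ⟨N, hN⟩ := h ε hε
  refine ⟨fun k => (ε : 𝕜) • z k, hz.const_smul hp _, ?_, N, fun n hn => ?_⟩
  · rw [← ENNReal.ofReal_one] at hz1
    simpa [abs_of_pos hε] using weakNorm_smul_le hp zero_le_one hz1 (ε : 𝕜)
  · obtain ⟨y, hy, hxy⟩ := hN n hn
    rw [hxy]
    exact smul_mem_conv _ hy

theorem UncondNull.tendsto_zero (hp : 1 ≤ p)
    (hpq : ENNReal.HolderConjugate (ENNReal.ofReal p) q) {x : ℕ → X}
    (hx : UncondNull 𝕜 p q x) : Tendsto x atTop (𝓝 0) := by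
  rw [Metric.tendsto_atTop]
  intro ε hε
  obtain ⟨z, -, hzε, N, hN⟩ := hx (ε / 2) (half_pos hε)
  refine ⟨N, fun n hn => ?_⟩
  rw [dist_zero_right]
  exact (norm_le_of_mem_conv hp hpq (half_pos hε).le hzε (hN n hn)).trans_lt (half_lt_self hε)

/-- The sequence `x 0, …, x (N - 1), z 0, z 1, …`. -/
def prepend (N : ℕ) (x z : ℕ → X) (k : ℕ) : X := if k < N then x k else z (k - N)

theorem UncondSummable.prepend (hp : 0 < p) {z : ℕ → X} (hz : UncondSummable 𝕜 p z) (N : ℕ)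
    (x : ℕ → X) : UncondSummable 𝕜 p (prepend N x z) := by
  rw [uncondSummable_iff hp] at hz ⊢
  intro ε hε
  obtain ⟨M, hM⟩ := hz ε hε
  refine ⟨N + M, fun f hf s hs => ?_⟩
  have hinj : Set.InjOn (fun k => k - N) s := fun i hi j hj hij => by
    have h1 := hs i hi
    have h2 := hs j hj
    simp only at hij
    omega
  have h := hM f hf (s.image fun k => k - N) fun k hk => by
    obtain ⟨i, hi, rfl⟩ := Finset.mem_image.1 hk
    have := hs i hi
    omega
  rw [Finset.sum_image hinj] at h
  refine (Finset.sum_congr rfl fun k hk => ?_).trans_le h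
  have := hs k hk
  rw [PNull.prepend, if_neg (by omega)]

theorem mem_conv_prepend_of_lt (N : ℕ) (x z : ℕ → X) {n : ℕ} (hn : n < N) :
    x n ∈ conv 𝕜 q (prepend N x z) := by
  refine ⟨ell.unit 𝕜 q n, ell.norm_unit n, ?_⟩
  convert hasSum_single n fun j hj => ?_ using 1
  · simp [ell.unit_apply, prepend, hn]
  · simp [ell.unit_apply, hj]

/-- Shift the coefficients by `N` places, filling with zeros. -/
theorem conv_subset_conv_prepend (N : ℕ) (x z : ℕ → X) :
    conv 𝕜 q z ⊆ conv 𝕜 q (prepend N x z) := by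
  rintro y ⟨a, ha, hay⟩
  have h_fin : q ≠ ∞ → ∀ s : Finset ℕ,
      ∑ k ∈ s, ‖if k < N then 0 else a.1 (k - N)‖ ^ q.toReal ≤ 1 ^ q.toReal := by
    intro hq s
    have hq0 := toReal_pos_of_ne_top hq
    have hinj : Set.InjOn (fun k => k - N) (s.filter fun k => N ≤ k) := fun i hi j hj hij => by
      simp only [Finset.coe_filter, Set.mem_ofPred_eq] at hi hj hij
      omega
    calc _ = ∑ k ∈ s with N ≤ k, ‖a.1 (k - N)‖ ^ q.toReal := by
          rw [Finset.sum_filter]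
          refine Finset.sum_congr rfl fun k _ => ?_
          by_cases h : k < N
          · simp [h, Real.zero_rpow hq0.ne']
          · simp [h, not_lt.1 h]
      _ = ∑ k ∈ (s.filter fun k => N ≤ k).image fun k => k - N, ‖a.1 k‖ ^ q.toReal :=
          (Finset.sum_image (f := fun k => ‖a.1 k‖ ^ q.toReal) hinj).symm
      _ ≤ ‖a‖ ^ q.toReal := ell.sum_rpow_le hq a _
      _ ≤ 1 ^ q.toReal := by gcongr
  have h_top : q = ∞ → (∀ k, ‖if k < N then 0 else a.1 (k - N)‖ ≤ 1) ∧
      Tendsto (fun k => if k < N then 0 else a.1 (k - N)) atTop (𝓝 0) := by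
    intro hq
    refine ⟨fun k => ?_, ?_⟩
    · split_ifs
      · simp
      · exact (ell.norm_apply_le a _).trans ha
    · refine ((a.2 hq).comp (tendsto_sub_atTop_nat N)).congr' ?_
      filter_upwards [eventually_ge_atTop N] with k hk
      simp [not_lt.2 hk]
  obtain ⟨b, hb, hb1⟩ := ell.exists_of_bound _ zero_le_one h_fin h_top
  refine ⟨b, hb1, ?_⟩
  have hinj : Function.Injective fun k : ℕ => k + N := add_left_injective N
  refine (hinj.hasSum_iff fun k hk => ?_).1 ?_
  · have : k < N := by
      by_contra h
      exact hk ⟨k - N, Nat.sub_add_cancel (not_lt.1 h)⟩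
    rw [hb, if_pos this, zero_smul]
  · convert hay using 2 with k
    simp [hb, prepend]

theorem UncondNull.relUncondCompact (hp : 0 < p) {x : ℕ → X} (hx : UncondNull 𝕜 p q x) :
    RelUncondCompact 𝕜 p q (Set.range x) := by
  obtain ⟨z, hz, -, N, hN⟩ := hx 1 one_pos
  refine ⟨prepend N x z, hz.prepend hp N x, ?_⟩
  rintro _ ⟨n, rfl⟩
  by_cases hn : n < N
  · exact mem_conv_prepend_of_lt N x z hn
  · exact conv_subset_conv_prepend N x z (hN n (not_lt.1 hn))

/-- A null sequence contained in a relatively unconditionally `p`-compact set is the image of a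
null sequence of `ℓ_q` under the operator of an unconditionally `p`-summable sequence. -/
theorem RelUncondCompact.exists_null_coeff [CompleteSpace X] (hp : 1 ≤ p)
    (hpq : ENNReal.HolderConjugate (ENNReal.ofReal p) q) {x : ℕ → X}
    (hx : RelUncondCompact 𝕜 p q (Set.range x)) (hx0 : Tendsto x atTop (𝓝 0)) :
    ∃ (z : ℕ → X) (y : ℕ → ell 𝕜 q), UncondSummable 𝕜 p z ∧ Tendsto y atTop (𝓝 0) ∧
      ∀ n, HasSum (fun k => (y n).1 k • z k) (x n) := by
  obtain ⟨z, hz, hxz⟩ := hx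
  obtain ⟨A, B, z', hA, -, hz', hBz', hBA⟩ := hz.exists_compact_factorization hp hpq
  choose a ha hax using fun n => hxz ⟨n, rfl⟩
  -- The coefficients `a n` are merely bounded; applying `A` moves them into a compact set, where
  -- lifting through `B` is possible.
  obtain ⟨K, hK, hKA⟩ := IsCompactOperator.image_closedBall_subset_compact
    (f := (A : ell 𝕜 q →ₗ[𝕜] ell 𝕜 q)) hA 1
  have hx' : ∀ n, B (A (a n)) = x n := fun n => (hBA (a n)).unique (hax n)
  obtain ⟨y, hy, hyx⟩ := exists_null_lift B hK (m := fun n => A (a n))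
    (fun n => hKA ⟨a n, mem_closedBall_zero_iff.2 (ha n), rfl⟩)
    (by simpa only [hx'] using hx0)
  refine ⟨z', y, hz', hy, fun n => ?_⟩
  rw [← hx', ← hyx]
  exact hBz' _

theorem unifUncondNull_of_null_coeff (hp : 0 < p) {x z : ℕ → X} {y : ℕ → ell 𝕜 q}
    (hz : UncondSummable 𝕜 p z) (hy : Tendsto y atTop (𝓝 0))
    (hx : ∀ n, HasSum (fun k => (y n).1 k • z k) (x n)) : UnifUncondNull 𝕜 p q x := by
  obtain ⟨C, hC, hCz⟩ := hz.exists_bound hp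
  have hC' : (C : 𝕜) ≠ 0 := RCLike.ofReal_ne_zero.2 hC.ne'
  refine ⟨fun k => (C : 𝕜)⁻¹ • z k, hz.const_smul hp _, ?_, fun ε hε => ?_⟩
  · have := weakNorm_smul_le hp hC.le ((weakNorm_le_ofReal_iff hp hC.le z).2 hCz) (C : 𝕜)⁻¹
    rwa [norm_inv, RCLike.norm_ofReal, abs_of_pos hC, inv_mul_cancel₀ hC.ne',
      ENNReal.ofReal_one] at this
  · have hε' : (ε : 𝕜) ≠ 0 := RCLike.ofReal_ne_zero.2 hε.ne'
    -- Dividing `z` by `C` and `x n` by `ε` multiplies the coefficients by `C / ε`.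
    obtain ⟨N, hN⟩ := Metric.tendsto_atTop.1 hy (ε / C) (by positivity)
    refine ⟨N, fun n hn => ⟨(ε : 𝕜)⁻¹ • x n,
      ⟨((ε : 𝕜)⁻¹ * C) • y n, ?_, ?_⟩, (smul_inv_smul₀ hε' _).symm⟩⟩
    · have h := (hN n hn).le
      rw [dist_zero_right, le_div_iff₀ hC] at h
      rw [norm_smul, norm_mul, norm_inv, RCLike.norm_ofReal, RCLike.norm_ofReal, abs_of_pos hε,
        abs_of_pos hC, mul_assoc, inv_mul_le_iff₀ hε]
      linarith
    · convert (hx n).const_smul (ε : 𝕜)⁻¹ using 2 with k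
      change ((ε : 𝕜)⁻¹ * C * (y n).1 k) • (C : 𝕜)⁻¹ • z k = _
      rw [smul_smul, smul_smul]
      congr 1
      field_simp

end Sequences

/-! ### The operator classes K_q and U_p -/

section Classes

variable {𝕜 : Type} [RCLike 𝕜] {X : Type u} [NormedAddCommGroup X] [NormedSpace 𝕜 X]
  {q : ℝ≥0∞} [Fact (1 ≤ q)] {p : ℝ}

theorem smul_mem_conv_of_hasSum {z : ℕ → X} {x : X} {a : ell 𝕜 q} {R : ℝ} (hR : 0 < R)
    (ha : ‖a‖ ≤ R) (hx : HasSum (fun k => a.1 k • z k) x) :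
    x ∈ conv 𝕜 q fun k => (R : 𝕜) • z k := by
  have hR' : (R : 𝕜) ≠ 0 := RCLike.ofReal_ne_zero.2 hR.ne'
  have h : (R : 𝕜)⁻¹ • x ∈ conv 𝕜 q z := by
    refine ⟨(R : 𝕜)⁻¹ • a, ?_, ?_⟩
    · rw [norm_smul, norm_inv, RCLike.norm_ofReal, abs_of_pos hR, inv_mul_le_iff₀ hR]
      simpa using ha
    · simpa [mul_smul] using hx.const_smul (R : 𝕜)⁻¹
  simpa [smul_inv_smul₀ hR'] using smul_mem_conv (R : 𝕜) h

/-- Expand `A y` in unit vectors: `B (A y)` has coefficients of norm at most `‖A‖` against the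
unconditionally `p`-summable `B eₖ`. -/
theorem classU_of_classK (hp : 1 ≤ p) (hpq : ENNReal.HolderConjugate (ENNReal.ofReal p) q)
    {Y : Type w} [NormedAddCommGroup Y] [NormedSpace 𝕜 Y] [CompleteSpace Y] {T : Y →L[𝕜] X}
    (hT : classK.{u, w} 𝕜 X q Y T) : classU.{u, w} 𝕜 X p q Y T := by
  obtain ⟨A, B, -, hB, rfl⟩ := hT
  refine ⟨_, (uncondSummable_of_isCompactOperator hp hpq B hB).const_smul (by linarith)
    ((‖A‖ + 1 : ℝ) : 𝕜), ?_⟩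
  rintro _ ⟨y, hy, rfl⟩
  refine smul_mem_conv_of_hasSum (a := A y) (by positivity) ?_ ?_
  · have := A.unit_le_opNorm y (mem_closedBall_zero_iff.1 hy)
    linarith
  · simpa using (ell.hasSum_unit (A y)).mapL B

/-- A relatively compact set lies in a ball of some radius `R`, which is absorbed into `z`. -/
theorem relUncondCompact_of_classU_compactSet (hp : 0 < p) {K : Set X}
    (hK : (classU.{u, w} 𝕜 X p q).CompactSet K) : RelUncondCompact 𝕜 p q K := by
  obtain ⟨Y, _, _, _, T, F, ⟨z, hz, hTz⟩, hF, hKF⟩ := hK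
  obtain ⟨R, hR, hFR⟩ := (hF.isBounded.subset subset_closure).exists_pos_norm_le
  have hR' : (R : 𝕜) ≠ 0 := RCLike.ofReal_ne_zero.2 hR.ne'
  refine ⟨_, hz.const_smul hp (R : 𝕜), fun x hx => ?_⟩
  obtain ⟨y, hy, rfl⟩ := hKF hx
  have h : T ((R : 𝕜)⁻¹ • y) ∈ conv 𝕜 q z := hTz ⟨_, by
    rw [mem_closedBall_zero_iff, norm_smul, norm_inv, RCLike.norm_ofReal, abs_of_pos hR,
      inv_mul_le_iff₀ hR, mul_one]
    exact hFR y hy, rfl⟩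
  have h2 := smul_mem_conv (R : 𝕜) h
  rwa [map_smul, smul_inv_smul₀ hR'] at h2

theorem OperatorClass.NullSeq.mono {𝒜 ℬ : OperatorClass.{u, w} 𝕜 X}
    (h : ∀ (Y : Type w) [NormedAddCommGroup Y] [NormedSpace 𝕜 Y] [CompleteSpace Y]
      (T : Y →L[𝕜] X), 𝒜 Y T → ℬ Y T) {x : ℕ → X} (hx : 𝒜.NullSeq x) : ℬ.NullSeq x := by
  obtain ⟨Y, _, _, _, T, y, hT, hy, hxy⟩ := hx
  exact ⟨Y, _, _, _, T, y, h Y T hT, hy, hxy⟩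

theorem OperatorClass.CompactSet.mono {𝒜 ℬ : OperatorClass.{u, w} 𝕜 X}
    (h : ∀ (Y : Type w) [NormedAddCommGroup Y] [NormedSpace 𝕜 Y] [CompleteSpace Y]
      (T : Y →L[𝕜] X), 𝒜 Y T → ℬ Y T) {K : Set X} (hK : 𝒜.CompactSet K) : ℬ.CompactSet K := by
  obtain ⟨Y, _, _, _, T, F, hT, hF, hKF⟩ := hK
  exact ⟨Y, _, _, _, T, F, h Y T hT, hF, hKF⟩

theorem OperatorClass.NullSeq.tendsto_and_compactSet {𝒜 : OperatorClass.{u, w} 𝕜 X} {x : ℕ → X}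
    (hx : 𝒜.NullSeq x) : Tendsto x atTop (𝓝 0) ∧ 𝒜.CompactSet (Set.range x) := by
  obtain ⟨Y, _, _, _, T, y, hT, hy, hxy⟩ := hx
  obtain rfl : x = fun n => T (y n) := funext hxy
  refine ⟨by simpa [Function.comp_def] using (T.continuous.tendsto 0).comp hy, Y, _, _, _, T, Set.range y, hT, ?_, ?_⟩
  · exact hy.isCompact_insert_range.closure_of_subset (Set.subset_insert _ _)
  · rintro _ ⟨n, rfl⟩
    exact ⟨y n, ⟨n, rfl⟩, rfl⟩

theorem classK_nullSeq_of_null_coeff [CompleteSpace X] (hp : 1 ≤ p)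
    (hpq : ENNReal.HolderConjugate (ENNReal.ofReal p) q) {x z : ℕ → X} {y : ℕ → ell 𝕜 q}
    (hz : UncondSummable 𝕜 p z) (hy : Tendsto y atTop (𝓝 0))
    (hx : ∀ n, HasSum (fun k => (y n).1 k • z k) (x n)) :
    (classK.{u, w} 𝕜 X q).NullSeq x := by
  obtain ⟨A, B, -, hA, hB, -, -, hBA⟩ := hz.exists_compact_factorization hp hpq
  -- The domain must live in universe `w`, whereas `ℓ_q` lives in `Type`.
  let e : ULift.{w} (ell 𝕜 q) ≃L[𝕜] ell 𝕜 q := ContinuousLinearEquiv.ulift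
  refine ⟨ULift.{w} (ell 𝕜 q), inferInstance, inferInstance, inferInstance,
    B.comp (A.comp (e : ULift.{w} (ell 𝕜 q) →L[𝕜] ell 𝕜 q)), fun n => e.symm (y n),
    ⟨A.comp (e : ULift.{w} (ell 𝕜 q) →L[𝕜] ell 𝕜 q), B, hA.comp_clm _, hB, rfl⟩, ?_,
    fun n => ?_⟩
  · simpa [Function.comp_def] using (e.symm.continuous.tendsto 0).comp hy
  · simpa using (hx n).unique (hBA (y n))

end Classes

end PNull

theorem corollary4p2 {𝕜 : Type} [RCLike 𝕜] {X : Type u} [NormedAddCommGroup X]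
    [NormedSpace 𝕜 X] [CompleteSpace X] (p : ℝ) (hp : 1 ≤ p) (q : ℝ≥0∞) [Fact (1 ≤ q)]
    (hpq : ENNReal.HolderConjugate (ENNReal.ofReal p) q) (x : ℕ → X) :
    List.TFAE [
      PNull.UncondNull 𝕜 p q x,
      Tendsto x atTop (𝓝 0) ∧ PNull.RelUncondCompact 𝕜 p q (Set.range x),
      Tendsto x atTop (𝓝 0) ∧ (PNull.classK.{u, w} 𝕜 X q).CompactSet (Set.range x),
      Tendsto x atTop (𝓝 0) ∧ (PNull.classU.{u, w} 𝕜 X p q).CompactSet (Set.range x),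
      (PNull.classK.{u, w} 𝕜 X q).NullSeq x,
      (PNull.classU.{u, w} 𝕜 X p q).NullSeq x,
      PNull.UnifUncondNull 𝕜 p q x] := by
  have hp0 : 0 < p := by linarith
  tfae_have 1 → 2 := fun h => ⟨h.tendsto_zero hp hpq, h.relUncondCompact hp0⟩
  tfae_have 2 → 7 := fun ⟨h0, h⟩ => by
    obtain ⟨z, y, hz, hy, hx⟩ := h.exists_null_coeff hp hpq h0
    exact PNull.unifUncondNull_of_null_coeff hp0 hz hy hx
  tfae_have 7 → 1 := fun h => h.uncondNull hp0
  tfae_have 2 → 5 := fun ⟨h0, h⟩ => by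
    obtain ⟨z, y, hz, hy, hx⟩ := h.exists_null_coeff hp hpq h0
    exact PNull.classK_nullSeq_of_null_coeff hp hpq hz hy hx
  tfae_have 5 → 3 := fun h => h.tendsto_and_compactSet
  tfae_have 5 → 6 := fun h => h.mono fun _ _ _ _ _ => PNull.classU_of_classK hp hpq
  tfae_have 6 → 4 := fun h => h.tendsto_and_compactSet
  tfae_have 3 → 4 := fun h =>
    ⟨h.1, h.2.mono fun _ _ _ _ _ => PNull.classU_of_classK hp hpq⟩
  tfae_have 4 → 2 := fun h => ⟨h.1, PNull.relUncondCompact_of_classU_compactSet hp0 h.2⟩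
  tfae_finish
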